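/- A quantale is a complete lattice $Q$ with an associative multiplication $\odot$ that distributes over arbitrary joins on both sides; it is semicartesian if $a\odot b\le a$ and $a\odot b\le b$ for all $a,b\in Q$. Write $1$ for the top element of $Q$ (in a semicartesian quantale with a unit, the unit is the top element). A presheaf $F:Q^{op}\to \mathrm{Set}$ is a sheaf if for every family $(u_i)_{i\in I}$ in $Q$ with join $u=\bigvee_{i\in I}u_i$ the diagram $$F(u)\to\prod_{i\in I}F(u_i)\rightrightarrows\prod_{(i,j)\in I\times I}F(u_i\odot u_j)$$ given by restriction maps is an equalizer. Let $PSh(Q)$ be the category of presheaves on $Q$ and $Sh(Q)$ its full subcategory of sheaves. Let $Q,Q'$ be (small) semicartesian quantales, with multiplications $\odot,\odot'$, and let $f:Q\to Q'$ be a geometric morphism, that is, a pair of adjoint monotone maps $f^*\dashv f_*$ with $f_*:Q\to Q'$ and $f^*:Q'\to Q$ such that $f^*$ preserves arbitrary suprema and $1$, and $f^*(p)\odot f^*(q)\le f^*(p\odot' q)$ for all $p,q\in Q'$. Theorem. For every sheaf $F$ on $Q$ the presheaf $F\circ f^*$ on $Q'$ is a sheaf, so that $\phi_*(F)=F\circ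 f^*$, $\phi_*(\eta)_u=\eta_{f^*(u)}$ defines a functor $\phi_*:Sh(Q)\to Sh(Q')$. The inclusion $Sh(Q)\to PSh(Q)$ has a left adjoint (sheafification) and, for every such left adjoint $a:PSh(Q)\to Sh(Q)$, the functor $$\phi^*:Sh(Q')\to Sh(Q),\qquad \phi^*(G)=a(\mathrm{Lan}_{f^*}G),$$ where $\mathrm{Lan}_{f^*}$ is the left Kan extension of presheaves along $f^*$, is left adjoint to $\phi_*$. -/

import Mathlib

open CategoryTheory Opposite

universe u

/-- A quantale is semicartesian if `a * b ≤ a` and `a * b ≤ b` for all `a`, `b`. -/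
class IsSemicartesian (Q : Type u) [Semigroup Q] [CompleteLattice Q] : Prop where
  mul_le_fst : ∀ a b : Q, a * b ≤ a
  mul_le_snd : ∀ a b : Q, a * b ≤ b

/-- If a semicartesian quantale has a unit, then this unit is the top element. -/
theorem IsSemicartesian.one_eq_top (Q : Type u) [Monoid Q] [CompleteLattice Q]
    [IsSemicartesian Q] : (1 : Q) = ⊤ :=
  top_le_iff.mp ((mul_one (⊤ : Q)).symm.le.trans (IsSemicartesian.mul_le_snd ⊤ 1))

/-- Presheaves of sets on the poset `Q`, regarded as a category. -/
abbrev QPresheaf (Q : Type u) [CompleteLattice Q] : Type (u + 1) := Qᵒᵖ ⥤ Type u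

namespace QPresheaf

/-- The restriction map `F(b) → F(a)` for `a ≤ b`. -/
def res {Q : Type u} [CompleteLattice Q] (F : QPresheaf Q) {a b : Q} (h : a ≤ b)
    (t : F.obj (op b)) : F.obj (op a) :=
  F.map (homOfLE h).op t

section Diagram

variable {Q : Type u} [Semigroup Q] [CompleteLattice Q] [IsSemicartesian Q]
  (F : QPresheaf Q) {I : Type u} (c : I → Q)

/-- The map `e : F(⨆ i, c i) → ∏ i, F(c i)`. -/
def diagramE (t : F.obj (op (⨆ i, c i))) (i : I) : F.obj (op (c i)) :=
  F.res (le_iSup c i) t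

/-- The map `p : ∏ i, F(c i) → ∏ (i, j), F(c i * c j)` restricting the `i`-th component. -/
def diagramP (s : ∀ i, F.obj (op (c i))) (ij : I × I) : F.obj (op (c ij.1 * c ij.2)) :=
  F.res (IsSemicartesian.mul_le_fst (c ij.1) (c ij.2)) (s ij.1)

/-- The map `q : ∏ i, F(c i) → ∏ (i, j), F(c i * c j)` restricting the `j`-th component. -/
def diagramQ (s : ∀ i, F.obj (op (c i))) (ij : I × I) : F.obj (op (c ij.1 * c ij.2)) :=
  F.res (IsSemicartesian.mul_le_snd (c ij.1) (c ij.2)) (s ij.2)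

end Diagram

/-- `F` is a sheaf if for every (possibly empty) family `c` the map `e` is an equalizer of
`p` and `q` in the category of sets: `p ∘ e = q ∘ e` holds by functoriality, and every `s` with
`p s = q s` is `e t` for exactly one `t`. -/
def IsSheaf (Q : Type u) [Semigroup Q] [CompleteLattice Q] [IsSemicartesian Q] :
    ObjectProperty (QPresheaf Q) := fun F =>
  ∀ (I : Type u) (c : I → Q) (s : ∀ i, F.obj (op (c i))),
    F.diagramP c s = F.diagramQ c s → ∃! t : F.obj (op (⨆ i, c i)), F.diagramE c t = s

end QPresheaf

/-- The category `Sh(Q)`: the full subcategory of presheaves that are sheaves. -/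
abbrev QSheaf (Q : Type u) [Semigroup Q] [CompleteLattice Q] [IsSemicartesian Q] :
    Type (u + 1) :=
  (QPresheaf.IsSheaf Q).FullSubcategory

/-- The inclusion of sheaves into presheaves. -/
abbrev QSheaf.inclusion (Q : Type u) [Semigroup Q] [CompleteLattice Q] [IsSemicartesian Q] :
    QSheaf Q ⥤ QPresheaf Q :=
  (QPresheaf.IsSheaf Q).ι

/-- A geometric morphism `f : Q → Q'` of quantales: an adjunction `f^* ⊣ f_*` of posets with
`f^* : Q' → Q` preserving suprema and the top element (the unit, for unital semicartesian
quantales), and weakly preserving multiplication. -/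
structure GeometricMorphism (Q Q' : Type u) [Semigroup Q] [CompleteLattice Q]
    [Semigroup Q'] [CompleteLattice Q'] where
  /-- The map `f_*`. -/
  directImage : Q → Q'
  /-- The map `f^*`. -/
  inverseImage : Q' → Q
  gc : GaloisConnection inverseImage directImage
  map_sSup : ∀ S : Set Q', inverseImage (sSup S) = sSup (inverseImage '' S)
  map_top : inverseImage ⊤ = ⊤
  mul_le_map_mul : ∀ p q : Q',
    inverseImage p * inverseImage q ≤ inverseImage (p * q)

namespace GeometricMorphism

variable {Q Q' : Type u} [Semigroup Q] [CompleteLattice Q] [Semigroup Q'] [CompleteLattice Q']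

/-- The functor between poset categories given by `f^*`. -/
def inverseImageFunctor (f : GeometricMorphism Q Q') : Q' ⥤ Q :=
  f.gc.monotone_l.functor

/-- Precomposition with `f^*`, sending a presheaf `F` on `Q` to `F ∘ f^*` on `Q'`, and a
natural transformation `η` to the one with components `η_{f^* u}`. -/
def precomp (f : GeometricMorphism Q Q') : QPresheaf Q ⥤ QPresheaf Q' :=
  (Functor.whiskeringLeft _ _ (Type u)).obj f.inverseImageFunctor.op

/-- The left Kan extension of presheaves along `f^*`. -/
noncomputable def leftKan (f : GeometricMorphism Q Q') : QPresheaf Q' ⥤ QPresheaf Q :=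
  f.inverseImageFunctor.op.lan

variable [IsSemicartesian Q] [IsSemicartesian Q']

/-- The functor `φ_* : Sh(Q) ⥤ Sh(Q')`, `F ↦ F ∘ f^*`, given that `F ∘ f^*` is a sheaf
whenever `F` is. -/
def sheafDirectImage (f : GeometricMorphism Q Q')
    (h : ∀ F : QPresheaf Q, QPresheaf.IsSheaf Q F → QPresheaf.IsSheaf Q' (f.precomp.obj F)) :
    QSheaf Q ⥤ QSheaf Q' :=
  (QPresheaf.IsSheaf Q').lift (QSheaf.inclusion Q ⋙ f.precomp) fun F => h F.obj F.property

/-- The functor `φ^* : Sh(Q') ⥤ Sh(Q)` obtained from a functor `a : PSh(Q) ⥤ Sh(Q)`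
by applying `a` to the left Kan extension along `f^*` of the underlying presheaf. -/
noncomputable def sheafInverseImage (f : GeometricMorphism Q Q')
    (a : QPresheaf Q ⥤ QSheaf Q) : QSheaf Q' ⥤ QSheaf Q :=
  QSheaf.inclusion Q' ⋙ f.leftKan ⋙ a

end GeometricMorphism

open CategoryTheory Opposite

namespace QPresheaf

section Restriction

variable {Q : Type u} [CompleteLattice Q] (F : QPresheaf Q)

/-! Since `f^*` preserves joins, it carries covers to covers. Sections compatible over `f^*(c i * c
j)` stay compatible over the smaller `f^*(c i) * f^*(c j)`, so `F ∘ f^*` inherits gluing from `F`.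
Sheafification is an orthogonal reflection: sheaves are the objects local for the morphisms `gluing
c ⟶ yoneda.obj (⨆ i, c i)`, and a small set of families `c` suffices (`isSheaf_iff_forall_set`).
Presheaves form a locally presentable category, so local objects are reflective. The adjunction
composes `Lan ⊣ precomp` with `a ⊣ inclusion` and restricts to sheaves on `Q'`. -/

@[simp]
theorem res_self {a : Q} (h : a ≤ a) (t : F.obj (op a)) : F.res h t = t :=
  F.map_id_apply _ t

@[simp]
theorem res_res {a b c : Q} (h : a ≤ b) (h' : b ≤ c) (t : F.obj (op c)) :
    F.res h (F.res h' t) = F.res (h.trans h') t :=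
  (F.map_comp_apply (homOfLE h').op (homOfLE h).op t).symm

theorem res_injective_of_eq {a b : Q} (h : a = b) : Function.Injective (F.res h.le) := by
  subst h
  intro x y hxy
  simpa using hxy

theorem app_res {F G : QPresheaf Q} (η : F ⟶ G) {a b : Q} (h : a ≤ b) (t : F.obj (op b)) :
    η.app (op a) (F.res h t) = G.res h (η.app (op b) t) :=
  NatTrans.naturality_apply η (homOfLE h).op t

end Restriction

/-! ### Sheaves as local objects for a small set of morphisms -/

section Families

variable {Q : Type u} [Semigroup Q] [CompleteLattice Q] [IsSemicartesian Q]
  (F : QPresheaf Q) {I : Type u} (c : I → Q)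

/-- The sheaf condition for a single family. -/
def IsSheafFor : Prop :=
  ∀ s : ∀ i, F.obj (op (c i)),
    F.diagramP c s = F.diagramQ c s → ∃! t : F.obj (op (⨆ i, c i)), F.diagramE c t = s

theorem diagramP_eq_diagramQ_iff (s : ∀ i, F.obj (op (c i))) :
    F.diagramP c s = F.diagramQ c s ↔
      ∀ i j, F.res (IsSemicartesian.mul_le_fst (c i) (c j)) (s i) =
        F.res (IsSemicartesian.mul_le_snd (c i) (c j)) (s j) :=
  ⟨fun h i j => congrFun h (i, j), fun h => funext fun ij => h ij.1 ij.2⟩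

/-- The presheaf that corepresents compatible families: the coequalizer of the two maps from
the sum of the presheaves represented by the products `c i * c j` to the sum of those
represented by the `c i`. -/
def gluing : QPresheaf Q where
  obj w := Quot fun i j : { i : I // w.unop ≤ c i } => w.unop ≤ c i * c j
  map {w v} g := ↾(Quot.map (fun i => ⟨i.1, g.unop.le.trans i.2⟩) fun _ _ h => g.unop.le.trans h)
  map_id w := by
    ext x
    induction x using Quot.ind
    rfl
  map_comp f g := by
    ext x
    induction x using Quot.ind
    rfl

/-- The generating sections of `gluing c`. -/
def gluingSection {w : Q} (i : I) (h : w ≤ c i) : (gluing c).obj (op w) :=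
  Quot.mk _ ⟨i, h⟩

omit [IsSemicartesian Q] in
theorem res_gluingSection {v w : Q} (hv : v ≤ w) (i : I) (h : w ≤ c i) :
    (gluing c).res hv (gluingSection c i h) = gluingSection c i (hv.trans h) :=
  rfl

theorem gluingSection_eq {w : Q} {i j : I} (h : w ≤ c i * c j) :
    gluingSection c i (h.trans (IsSemicartesian.mul_le_fst _ _)) =
      gluingSection c j (h.trans (IsSemicartesian.mul_le_snd _ _)) :=
  Quot.sound h

variable {F c}

omit [IsSemicartesian Q] in
theorem gluing_hom_ext {f g : gluing c ⟶ F}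
    (h : ∀ i, f.app (op (c i)) (gluingSection c i le_rfl) =
      g.app (op (c i)) (gluingSection c i le_rfl)) : f = g := by
  ext w x
  induction x using Quot.ind with
  | mk x =>
    have := congrArg (F.res x.2) (h x.1)
    rw [← app_res, ← app_res, res_gluingSection] at this
    exact this

/-- The morphism from `gluing c` given by a compatible family. -/
def gluingDesc (s : ∀ i, F.obj (op (c i))) (hs : F.diagramP c s = F.diagramQ c s) :
    gluing c ⟶ F where
  app w := ↾(Quot.lift (fun i => F.res (a := w.unop) i.2 (s i.1)) fun i j h => by
    have := congrArg (F.res h) ((diagramP_eq_diagramQ_iff F c s).1 hs i.1 j.1)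
    simpa using this)
  naturality w v g := by
    ext x
    induction x using Quot.ind with
    | mk x => exact (res_res F g.unop.le x.2 (s x.1)).symm

theorem gluingDesc_app (s : ∀ i, F.obj (op (c i))) (hs : F.diagramP c s = F.diagramQ c s) (i : I) :
    (gluingDesc s hs).app (op (c i)) (gluingSection c i le_rfl) = s i :=
  res_self F _ _

theorem compatible_of_gluing_hom (f : gluing c ⟶ F) :
    F.diagramP c (fun i => f.app (op (c i)) (gluingSection c i le_rfl)) =
      F.diagramQ c (fun i => f.app (op (c i)) (gluingSection c i le_rfl)) := by
  rw [diagramP_eq_diagramQ_iff]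
  intro i j
  rw [← app_res, ← app_res, res_gluingSection, res_gluingSection,
    gluingSection_eq c le_rfl]

variable (c)

/-- The comparison of `gluing c` with the presheaf represented by the join of `c`. -/
def gluingToYoneda : gluing c ⟶ yoneda.obj (⨆ i, c i) where
  app w := ↾(Quot.lift (fun i => homOfLE (i.2.trans (le_iSup c i.1))) fun _ _ _ => rfl)
  naturality _ _ _ := by
    ext x
    exact Subsingleton.elim (α := (_ : Q) ⟶ _) _ _

omit [IsSemicartesian Q] in
theorem gluingToYoneda_comp_app (g : yoneda.obj (⨆ i, c i) ⟶ F) (i : I) :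
    (gluingToYoneda c ≫ g).app (op (c i)) (gluingSection c i le_rfl) =
      F.diagramE c (yonedaEquiv g) i := by
  rw [diagramE, yonedaEquiv_apply, ← app_res]
  rfl

/-- Maps out of `gluing c` are compatible families, and by Yoneda precomposition with the comparison
becomes `diagramE`. -/
theorem bijective_gluingToYoneda_comp_iff :
    Function.Bijective (fun g : yoneda.obj (⨆ i, c i) ⟶ F => gluingToYoneda c ≫ g) ↔
      F.IsSheafFor c := by
  rw [Function.bijective_iff_existsUnique]
  constructor
  · intro h s hs
    obtain ⟨g, hg, hu⟩ := h (gluingDesc s hs)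
    refine ⟨yonedaEquiv g, ?_, fun t ht => ?_⟩
    · funext i
      rw [← gluingToYoneda_comp_app, ← gluingDesc_app s hs]
      exact congrArg (fun k : gluing c ⟶ F => k.app (op (c i)) (gluingSection c i le_rfl)) hg
    · rw [← hu (yonedaEquiv.symm t), Equiv.apply_symm_apply]
      refine gluing_hom_ext fun i => ?_
      rw [gluingToYoneda_comp_app, gluingDesc_app, Equiv.apply_symm_apply, ht]
  · intro h k
    obtain ⟨t, ht, hu⟩ := h _ (compatible_of_gluing_hom k)
    refine ⟨yonedaEquiv.symm t, ?_, fun g hg => ?_⟩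
    · refine gluing_hom_ext fun i => ?_
      rw [gluingToYoneda_comp_app, Equiv.apply_symm_apply, ht]
    · rw [Equiv.eq_symm_apply]
      refine hu _ (funext fun i => ?_)
      rw [← gluingToYoneda_comp_app]
      exact congrArg (fun k : gluing c ⟶ F => k.app (op (c i)) (gluingSection c i le_rfl)) hg

/-- The comparison morphisms of a set of families that detects sheaves. The factor `Bool` allows
elements of `Q` to be repeated in a family. -/
def localizing (Q : Type u) [Semigroup Q] [CompleteLattice Q] [IsSemicartesian Q] :
    MorphismProperty (QPresheaf Q) :=
  .ofHoms fun S : Set (Q × Bool) => gluingToYoneda fun p : S => p.1.1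

theorem isLocal_localizing_iff :
    (localizing Q).isLocal F ↔ ∀ S : Set (Q × Bool), F.IsSheafFor fun p : S => p.1.1 := by
  constructor
  · intro h S
    exact (bijective_gluingToYoneda_comp_iff _).1 (h _ ⟨S⟩)
  · rintro h _ _ _ ⟨S⟩
    exact (bijective_gluingToYoneda_comp_iff _).2 (h S)

/-- Cover `u` by two copies of itself, carrying `x` and `y`. Agreement on `u * u` is exactly
compatibility, and the glued section equals both. -/
theorem eq_of_res_mul_eq (h : ∀ S : Set (Q × Bool), F.IsSheafFor fun p : S => p.1.1) {u : Q}
    (x y : F.obj (op u))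
    (hxy : F.res (IsSemicartesian.mul_le_fst u u) x = F.res (IsSemicartesian.mul_le_fst u u) y) :
    x = y := by
  let S : Set (Q × Bool) := { p | p.1 = u }
  obtain ⟨t, ht, -⟩ := h S (fun p => F.res p.2.le (bif p.1.2 then x else y)) <| by
    rw [diagramP_eq_diagramQ_iff]
    rintro ⟨⟨v, b⟩, hv⟩ ⟨⟨v', b'⟩, hv'⟩
    obtain rfl : v = u := hv
    obtain rfl : v' = v := hv'
    cases b <;> cases b' <;> simp [hxy]
  have hx := congrFun ht ⟨(u, true), rfl⟩
  have hy := congrFun ht ⟨(u, false), rfl⟩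
  simp only [res_self, cond_true, cond_false] at hx hy
  exact hx.symm.trans hy

/-- A family may repeat a value arbitrarily often, so it is replaced by its set of values, each
taken twice. -/
theorem isSheaf_iff_forall_set :
    IsSheaf Q F ↔ ∀ S : Set (Q × Bool), F.IsSheafFor fun p : S => p.1.1 := by
  refine ⟨fun h S => h _ _, fun h I c s hs => ?_⟩
  rw [diagramP_eq_diagramQ_iff] at hs
  let S : Set (Q × Bool) := { p | ∃ i, c i = p.1 }
  choose r hr using fun p : S => p.2
  have hsup : ⨆ p : S, p.1.1 = ⨆ i, c i :=
    le_antisymm (iSup_le fun p => (hr p).symm.le.trans (le_iSup c _))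
      (iSup_le fun i => le_iSup (fun p : S => p.1.1) ⟨(c i, true), i, rfl⟩)
  obtain ⟨t, ht, hu⟩ := h S (fun p => F.res (hr p).symm.le (s (r p))) <| by
    rw [diagramP_eq_diagramQ_iff]
    intro p q
    have := congrArg (F.res (by rw [hr, hr] : p.1.1 * q.1.1 ≤ c (r p) * c (r q))) (hs (r p) (r q))
    simpa using this
  -- Indices with equal value carry equal sections. Compatibility alone gives this only on `v * v`,
  -- which may lie strictly below `v`.
  have key : ∀ p : S, ∀ i, (hi : c i = p.1.1) →
      F.res hi.symm.le (s i) = F.res (hr p).symm.le (s (r p)) := by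
    intro p i hi
    refine eq_of_res_mul_eq h _ _ ?_
    have := congrArg (F.res (by rw [hr, hi] : p.1.1 * p.1.1 ≤ c i * c (r p))) (hs i (r p))
    simpa using this
  refine ⟨F.res hsup.symm.le t, ?_, fun t' ht' => ?_⟩
  · funext i
    have h₁ := congrFun ht ⟨(c i, true), i, rfl⟩
    rw [← key _ i rfl] at h₁
    simpa [diagramE] using h₁
  · apply res_injective_of_eq F hsup
    rw [res_res, res_self]
    refine hu _ (funext fun p => ?_)
    have := congrArg (F.res (hr p).symm.le) (congrFun ht' (r p))
    simpa [diagramE] using this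

theorem isSheaf_eq_isLocal_localizing : IsSheaf Q = (localizing Q).isLocal := by
  ext F
  rw [isLocal_localizing_iff, isSheaf_iff_forall_set]

end Families

end QPresheaf

/-! ### Existence of sheafification -/

theorem CategoryTheory.exists_isCardinalPresentable_of_small {C : Type*} [Category.{u} C]
    [IsLocallyPresentable.{u} C] {ι : Type u} (X : ι → C) :
    ∃ (κ : Cardinal.{u}) (_ : Fact κ.IsRegular), ∀ i, IsCardinalPresentable (X i) κ := by
  choose κ hκ h using fun i => (inferInstance : IsPresentable.{u} (X i)).exists_cardinal
  -- A successor of an infinite cardinal is regular and bounds every `κ i`.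
  let κ' := Order.succ (max Cardinal.aleph0 (⨆ i, κ i))
  have hκ' : Fact κ'.IsRegular := ⟨Cardinal.isRegular_succ (le_max_left _ _)⟩
  refine ⟨κ', hκ', fun i => ?_⟩
  have : IsCardinalPresentable (X i) (κ i) := h i
  exact isCardinalPresentable_of_le (X i)
    (((le_ciSup (Cardinal.bddAbove_of_small) i).trans (le_max_right _ _)).trans (Order.le_succ _))

namespace QSheaf

theorem isRightAdjoint_inclusion (Q : Type u) [Semigroup Q] [CompleteLattice Q]
    [IsSemicartesian Q] : (QSheaf.inclusion Q).IsRightAdjoint := by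
  obtain ⟨κ, hκ, h⟩ := exists_isCardinalPresentable_of_small (C := QPresheaf Q)
    (Sum.elim (fun S : Set (Q × Bool) => QPresheaf.gluing fun p : S => p.1.1)
      fun S : Set (Q × Bool) => yoneda.obj (⨆ p : S, p.1.1))
  have : MorphismProperty.IsSmall.{u} (QPresheaf.localizing Q) := by
    unfold QPresheaf.localizing
    infer_instance
  have key : (QPresheaf.localizing Q).isLocal.ι.IsRightAdjoint :=
    (QPresheaf.localizing Q).isRightAdjoint_ι_isLocal κ <| by
      rintro _ _ _ ⟨S⟩
      exact ⟨h (.inl S), h (.inr S)⟩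
  generalize hP : (QPresheaf.localizing Q).isLocal = P at key
  obtain rfl : P = QPresheaf.IsSheaf Q := hP.symm.trans QPresheaf.isSheaf_eq_isLocal_localizing.symm
  exact key

end QSheaf

/-! ### Direct image and the adjunction -/

namespace GeometricMorphism

variable {Q Q' : Type u} [Semigroup Q] [CompleteLattice Q] [Semigroup Q'] [CompleteLattice Q']
  [IsSemicartesian Q] [IsSemicartesian Q'] (f : GeometricMorphism Q Q')

theorem isSheaf_precomp {F : QPresheaf Q} (hF : QPresheaf.IsSheaf Q F) :
    QPresheaf.IsSheaf Q' (f.precomp.obj F) := by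
  intro I c (s : ∀ i, F.obj (op (f.inverseImage (c i)))) hs
  replace hs : ∀ i j,
      F.res (f.gc.monotone_l (IsSemicartesian.mul_le_fst (c i) (c j))) (s i) =
        F.res (f.gc.monotone_l (IsSemicartesian.mul_le_snd (c i) (c j))) (s j) :=
    (QPresheaf.diagramP_eq_diagramQ_iff (f.precomp.obj F) c s).1 hs
  have hsup : ⨆ i, f.inverseImage (c i) = f.inverseImage (⨆ i, c i) := f.gc.l_iSup.symm
  obtain ⟨t, ht, hu⟩ := hF I (fun i => f.inverseImage (c i)) s <| by
    rw [QPresheaf.diagramP_eq_diagramQ_iff]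
    intro i j
    simpa using congrArg (F.res (f.mul_le_map_mul (c i) (c j))) (hs i j)
  suffices ∃! t : F.obj (op (f.inverseImage (⨆ i, c i))),
      (fun i => F.res (f.gc.monotone_l (le_iSup c i)) t) = s from this
  refine ⟨F.res hsup.symm.le t, ?_, fun t' ht' => ?_⟩
  · funext i
    rw [F.res_res]
    exact congrFun ht i
  · apply F.res_injective_of_eq hsup
    rw [F.res_res, F.res_self]
    refine hu _ (funext fun i => ?_)
    rw [QPresheaf.diagramE, F.res_res]
    exact congrFun ht' i

/-- Sheafified left Kan extension along `f^*` is left adjoint to `φ_*`. -/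
noncomputable def sheafAdjunction
    (h : ∀ F : QPresheaf Q, QPresheaf.IsSheaf Q F → QPresheaf.IsSheaf Q' (f.precomp.obj F))
    {a : QPresheaf Q ⥤ QSheaf Q} (adj : a ⊣ QSheaf.inclusion Q) :
    f.sheafInverseImage a ⊣ f.sheafDirectImage h :=
  ((f.inverseImageFunctor.op.lanAdjunction (Type u)).comp adj).restrictFullyFaithful
    (QPresheaf.IsSheaf Q').fullyFaithfulι (Functor.FullyFaithful.id _) (Iso.refl _) (Iso.refl _)

end GeometricMorphism

theorem mainTheorem4 {Q Q' : Type u}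
    [Semigroup Q] [CompleteLattice Q] [IsQuantale Q] [IsSemicartesian Q]
    [Semigroup Q'] [CompleteLattice Q'] [IsQuantale Q'] [IsSemicartesian Q']
    (f : GeometricMorphism Q Q') :
    ∃ h : ∀ F : QPresheaf Q, QPresheaf.IsSheaf Q F → QPresheaf.IsSheaf Q' (f.precomp.obj F),
      (QSheaf.inclusion Q).IsRightAdjoint ∧
      ∀ a : QPresheaf Q ⥤ QSheaf Q, Nonempty (a ⊣ QSheaf.inclusion Q) →
        Nonempty (f.sheafInverseImage a ⊣ f.sheafDirectImage h) :=
  ⟨fun _ => f.isSheaf_precomp, QSheaf.isRightAdjoint_inclusion Q,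
    fun _ ⟨adj⟩ => ⟨f.sheafAdjunction _ adj⟩⟩
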